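/- Let $\mathbb F$ be a field of characteristic different from $2$. An $n$-SLTM is a strictly lower triangular $n\times n$ matrix $T=[t_{ij}]$ over $\mathbb F$ (so $t_{ij}=0$ for $i\le j$); an SLTM is an $n$-SLTM for some $n$. For an $n$-SLTM $T$, let $\mathcal A(T)$ be the commutative unital $\mathbb F$-algebra with generators $X_1,\dots,X_n$ and relations $X_i^2=\sum_{j<i}t_{ij}X_jX_i$ for $1\le i\le n$ (in particular $X_1^2=0$), graded by $\deg X_i=2$. Write $T\sim S$ if there is a degree-preserving isomorphism of unital $\mathbb F$-algebras $\mathcal A(T)\cong\mathcal A(S)$. Let $c_r=\max\{j:t_{rj}\ne0\}$ if the $r$-th row of $T$ is nonzero, and $c_r=0$ otherwise; if $c_r>0$, then $(r,c_r)$ is called a leader position. An $n$-SLTM $T$ is in first reduced echelon form ($1$-REF) if $T=0$, or if the following hold: (1) all zero rows are above all nonzero rows; (2) for each leader position $(r,c)$ we have $c>1$ and there is an $i$ with $1\le i<c$ and $2t_{ri}+t_{rc}t_{ci}\neq0$; (3) $c_r\le c_{r+1}$ whenever rows $r$ and $r+1$ are both nonzero. The wall $\mathbb W(T)$ of a nonzero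 $n$-SLTM $T$ in $1$-REF is the vector $(r_1,\dots,r_h)$ defined as follows: $r_1$ is the index of the first nonzero row; given $r_j$, put $A_j=\{r: r_j<r\le n,\ c_r\ge r_j\}$; if $A_j\ne\emptyset$ then $r_{j+1}=\min A_j$, and if $A_j=\emptyset$ the vector ends with $r_j$, that is, $h=j$. The wall of the zero matrix is $(0)$. Then: 1. If $S,T$ are $n$-SLTMs, both in $1$-REF, and $S\sim T$, then $\mathbb W(S)=\mathbb W(T)$. 2. For every $n$-SLTM $T$ there is an $n$-SLTM $R$ in $1$-REF with $T\sim R$, and the vector $\mathbb W(R)$ is the same for all such $R$. Hence $\mathbb W(T):=\mathbb W(R)$ is well defined for every SLTM $T$. 3. If $T,S$ are SLTMs (of any sizes) with $T\sim S$, then, for the walls as extended in 2, $\mathbb W(T)=\mathbb W(S)$. -/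

import Mathlib

/-!
Strictly lower triangular matrices, their nil graded algebras, the first reduced echelon form and
walls. Rows and columns are indexed by `Fin n`, that is by `0, …, n - 1`. The entries of a wall and
the leader columns `c_r` are natural numbers in the usual numbering `1, …, n`, the number of the
index `i : Fin n` being `(i : ℕ) + 1`; the value `c_r = 0` means that row `r` is zero.
-/

namespace SLTM

variable {F : Type*} [Field F]

/-- `T` is a strictly lower triangular matrix. -/
def IsSLTM {n : ℕ} (T : Matrix (Fin n) (Fin n) F) : Prop :=
  ∀ i j : Fin n, i ≤ j → T i j = 0

/-- The ideal of the relations `X_i ^ 2 = ∑_{j < i} t_{ij} X_j X_i`, for all `i`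
(for the first index the sum is empty). -/
noncomputable def relIdeal {n : ℕ} (T : Matrix (Fin n) (Fin n) F) :
    Ideal (MvPolynomial (Fin n) F) :=
  Ideal.span (Set.range fun i : Fin n =>
    (MvPolynomial.X i ^ 2 -
      ∑ j ∈ Finset.univ.filter (fun j : Fin n => j < i),
        MvPolynomial.C (T i j) * MvPolynomial.X j * MvPolynomial.X i :
      MvPolynomial (Fin n) F))

/-- The nil graded algebra `A(T)`. -/
abbrev NilAlg {n : ℕ} (T : Matrix (Fin n) (Fin n) F) : Type _ :=
  MvPolynomial (Fin n) F ⧸ relIdeal T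

/-- The homogeneous component of degree `d` of `A(T)`, for the grading with `deg X_i = 2`. -/
noncomputable def component {n : ℕ} (T : Matrix (Fin n) (Fin n) F) (d : ℕ) :
    Submodule F (NilAlg T) :=
  (MvPolynomial.weightedHomogeneousSubmodule F (fun _ : Fin n => (2 : ℕ)) d).map
    (Ideal.Quotient.mkₐ F (relIdeal T)).toLinearMap

/-- `T ∼ S`: there is an isomorphism of unital `F`-algebras `A(T) → A(S)` which, together with its
inverse, preserves degrees. -/
def Sim {m n : ℕ} (T : Matrix (Fin m) (Fin m) F) (S : Matrix (Fin n) (Fin n) F) : Prop :=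
  ∃ e : NilAlg T ≃ₐ[F] NilAlg S, ∀ (d : ℕ) (x : NilAlg T), e x ∈ component S d ↔ x ∈ component T d

/-- `Δ^{(α)}_{i,j,k}(T) = α t_{ki} + t_{kj} t_{ji}`. -/
def Delta {n : ℕ} (α : F) (T : Matrix (Fin n) (Fin n) F) (i j k : Fin n) : F :=
  α * T k i + T k j * T j i

/-- `(r, c)` is the leader position of row `r`: the entry `t_{rc}` is the last nonzero one. -/
def IsLeader {n : ℕ} (T : Matrix (Fin n) (Fin n) F) (r c : Fin n) : Prop :=
  T r c ≠ 0 ∧ ∀ j : Fin n, c < j → T r j = 0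

/-- The first reduced echelon form. The zero matrix satisfies the three conditions vacuously. -/
structure IsFirstREF {n : ℕ} (T : Matrix (Fin n) (Fin n) F) : Prop where
  /-- The zero rows are above the nonzero rows. -/
  zero_above : ∀ r r' : Fin n, (∀ j : Fin n, T r j = 0) → (∃ j : Fin n, T r' j ≠ 0) → r < r'
  /-- At a leader position `(r, c)` some `Δ^{(2)}_{i,c,r}` with `i < c` is nonzero; in particular
  `c` is not the first column. -/
  delta_ne : ∀ r c : Fin n, IsLeader T r c → ∃ i : Fin n, i < c ∧ Delta 2 T i c r ≠ 0
  /-- The leader columns of consecutive nonzero rows are weakly increasing. -/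
  leader_mono : ∀ r r' c c' : Fin n, (r' : ℕ) = (r : ℕ) + 1 →
    IsLeader T r c → IsLeader T r' c' → c ≤ c'

section Wall

variable [DecidableEq F] {n : ℕ}

/-- `c_r`: the number (counted from `1`) of the last column in which row `r` is nonzero, and `0` if
row `r` is zero. -/
def leaderCol (T : Matrix (Fin n) (Fin n) F) (r : Fin n) : ℕ :=
  (Finset.univ.filter fun j : Fin n => T r j ≠ 0).sup fun j => (j : ℕ) + 1

/-- The numbers (counted from `1`) of the nonzero rows, that is of the rows with `c_r ≠ 0`. -/
def nonzeroRows (T : Matrix (Fin n) (Fin n) F) : Finset ℕ :=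
  (Finset.univ.filter fun r : Fin n => leaderCol T r ≠ 0).image fun r : Fin n => (r : ℕ) + 1

/-- The set of the numbers `r` (counted from `1`) of rows with `r > q` and `c_r ≥ q`. -/
def laterRows (T : Matrix (Fin n) (Fin n) F) (q : ℕ) : Finset ℕ :=
  (Finset.univ.filter fun r : Fin n => q < (r : ℕ) + 1 ∧ q ≤ leaderCol T r).image
    fun r : Fin n => (r : ℕ) + 1

theorem lt_of_mem_laterRows {T : Matrix (Fin n) (Fin n) F} {q r : ℕ} (h : r ∈ laterRows T q) :
    q < r ∧ r ≤ n := by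
  simp only [laterRows, Finset.mem_image, Finset.mem_filter] at h
  obtain ⟨a, ⟨-, h1, -⟩, rfl⟩ := h
  exact ⟨h1, a.isLt⟩

/-- The sequence `q = r_j, r_{j+1}, …`, where each next term is the least element of
`laterRows` of the current one, as long as that set is nonempty. -/
def wallFrom (T : Matrix (Fin n) (Fin n) F) (q : ℕ) : List ℕ :=
  q :: (if h : (laterRows T q).Nonempty then wallFrom T ((laterRows T q).min' h) else [])
termination_by n - q
decreasing_by
  have := lt_of_mem_laterRows (Finset.min'_mem (laterRows T q) h)
  omega

/-- The wall `(r_1, …, r_h)` of a matrix in first reduced echelon form: `r_1` is the number of the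
first nonzero row; the wall of the zero matrix is `(0)`. -/
def wall (T : Matrix (Fin n) (Fin n) F) : List ℕ :=
  if h : (nonzeroRows T).Nonempty then wallFrom T ((nonzeroRows T).min' h) else [0]

open Classical in
/-- The wall of an arbitrary strictly lower triangular matrix `T`: the wall of a strictly lower
triangular matrix `R` in first reduced echelon form with `T ∼ R`. -/
noncomputable def generalWall (T : Matrix (Fin n) (Fin n) F) : List ℕ :=
  if h : ∃ R : Matrix (Fin n) (Fin n) F, IsSLTM R ∧ IsFirstREF R ∧ Sim T R then
    wall h.choose
  else []

end Wall

end SLTM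

/-! Existence is a descent on the vector of leader columns `(c_1, …, c_n)`, ordered
lexicographically. If `c_{r+1} < c_r`, exchanging `X_r` and `X_{r+1}` lowers it
(`IsSLTM.exists_swap_lt`). If all `Δ^{(2)}_{i,c,r}` vanish at a leader `(r, c)`, completing the
square by `X_r ↦ X_r - (t_{rc}/2) X_c` removes that leader and keeps the rows above
(`IsSLTM.exists_removeLeader_lt`). Both moves are graded isomorphisms, so a minimal matrix in the
similarity class is in 1-REF.

Invariance comes from the filtration `U_0 = 0`, `U_{k+1} = span {v | v² ∈ U_k U_k}` of the component
of degree 2, which every graded isomorphism respects. For `T` in 1-REF each `U_k` is a coordinate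
flag `V_q = span {X_j | j < q}`, since `span {v | v² ∈ V_q V_q} = V_{q'}` with `q' = nextRow T q`
(`span_eq_flag_nextRow`). One inclusion completes the square; the other reads the coefficients of
`v²` at `X_i X_j`, and condition (2) excludes further `v`. Hence `dim U_k + 1` is the `k`-th iterate
of `nextRow T` at `1`, and the wall is this orbit after its starting point, cut off at `n`. Finally,
the dimension of the component of degree 2 recovers `n`, which allows matrices of different sizes.
-/

namespace SLTM

open MvPolynomial

/-! ### Graded isomorphisms induced by linear substitutions -/

section Similarity

variable {F : Type*} [Field F]

/-- The linear form `∑_j t_{kj} X_j` of the `k`-th row. -/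
noncomputable def rowForm {n : ℕ} (T : Matrix (Fin n) (Fin n) F) (k : Fin n) :
    MvPolynomial (Fin n) F :=
  ∑ j, C (T k j) * X j

/-- The defining relation of index `k`. -/
noncomputable def rel {n : ℕ} (T : Matrix (Fin n) (Fin n) F) (k : Fin n) :
    MvPolynomial (Fin n) F :=
  X k ^ 2 - rowForm T k * X k

theorem IsSLTM.relIdeal_eq {n : ℕ} {T : Matrix (Fin n) (Fin n) F} (hT : IsSLTM T) :
    relIdeal T = Ideal.span (Set.range (rel T)) := by
  unfold relIdeal
  congr 2
  funext i
  simp only [rel, rowForm, Finset.sum_mul]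
  congr 1
  refine Finset.sum_subset (Finset.subset_univ _) fun j _ hj => ?_
  simp only [Finset.mem_filter, Finset.mem_univ, true_and, not_lt] at hj
  simp [hT i j hj]

theorem IsSLTM.rel_mem {n : ℕ} {T : Matrix (Fin n) (Fin n) F} (hT : IsSLTM T) (k : Fin n) :
    rel T k ∈ relIdeal T := by
  rw [hT.relIdeal_eq]
  exact Ideal.subset_span ⟨k, rfl⟩

theorem Sim.refl {n : ℕ} (T : Matrix (Fin n) (Fin n) F) : Sim T T :=
  ⟨AlgEquiv.refl, fun _ _ => Iff.rfl⟩

theorem Sim.symm {m n : ℕ} {T : Matrix (Fin m) (Fin m) F} {S : Matrix (Fin n) (Fin n) F}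
    (h : Sim T S) : Sim S T := by
  obtain ⟨e, he⟩ := h
  refine ⟨e.symm, fun d x => ?_⟩
  rw [← he, e.apply_symm_apply]

theorem Sim.trans {l m n : ℕ} {T : Matrix (Fin l) (Fin l) F} {S : Matrix (Fin m) (Fin m) F}
    {R : Matrix (Fin n) (Fin n) F} (h : Sim T S) (h' : Sim S R) : Sim T R := by
  obtain ⟨e, he⟩ := h
  obtain ⟨e', he'⟩ := h'
  exact ⟨e.trans e', fun d x => by rw [AlgEquiv.trans_apply, he', he]⟩

theorem isWeightedHomogeneous_algHom {n : ℕ}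
    {E : MvPolynomial (Fin n) F →ₐ[F] MvPolynomial (Fin n) F}
    (hE : ∀ i, IsWeightedHomogeneous (fun _ : Fin n => 2) (E (X i)) 2) {d : ℕ}
    {p : MvPolynomial (Fin n) F} (hp : IsWeightedHomogeneous (fun _ : Fin n => 2) p d) :
    IsWeightedHomogeneous (fun _ : Fin n => 2) (E p) d := by
  induction hp using IsWeightedHomogeneous.induction_on with
  | zero => rw [map_zero]; exact isWeightedHomogeneous_zero _ _ _
  | add p q hp hq ihp ihq => rw [map_add]; exact ihp.add ihq
  | monomial m r hm =>
    rw [monomial_eq, map_mul, Finsupp.prod, map_prod, ← algebraMap_eq, AlgHom.commutes,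
      algebraMap_eq]
    refine IsWeightedHomogeneous.C_mul ?_ r
    have := IsWeightedHomogeneous.prod m.support (fun i => E (X i ^ m i)) (fun i => m i • 2)
      (w := fun _ : Fin n => 2) fun i _ => by rw [map_pow]; exact (hE i).pow _
    rw [← hm]
    exact this

theorem sim_of_algEquiv {n : ℕ} {T S : Matrix (Fin n) (Fin n) F} (hT : IsSLTM T) (hS : IsSLTM S)
    (E : MvPolynomial (Fin n) F ≃ₐ[F] MvPolynomial (Fin n) F)
    (hE : ∀ i, IsWeightedHomogeneous (fun _ : Fin n => 2) (E (X i)) 2)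
    (hE' : ∀ i, IsWeightedHomogeneous (fun _ : Fin n => 2) (E.symm (X i)) 2)
    (hTS : ∀ k, E (rel T k) ∈ relIdeal S) (hST : ∀ k, E.symm (rel S k) ∈ relIdeal T) :
    Sim T S := by
  have hI : relIdeal S =
      (relIdeal T).map (E : MvPolynomial (Fin n) F →+* MvPolynomial (Fin n) F) := by
    apply le_antisymm
    · rw [hS.relIdeal_eq, Ideal.span_le]
      rintro _ ⟨k, rfl⟩
      have := Ideal.mem_map_of_mem (E : MvPolynomial (Fin n) F →+* MvPolynomial (Fin n) F) (hST k)
      simpa using this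
    · rw [hT.relIdeal_eq, Ideal.map_span, Ideal.span_le]
      rintro _ ⟨_, ⟨k, rfl⟩, rfl⟩
      exact hTS k
  have key (d : ℕ) (p : MvPolynomial (Fin n) F) :
      Ideal.quotientEquivAlg (relIdeal T) (relIdeal S) E hI (Ideal.Quotient.mk _ p) =
        Ideal.Quotient.mk _ (E p) := rfl
  refine ⟨Ideal.quotientEquivAlg (relIdeal T) (relIdeal S) E hI, fun d x => ⟨?_, ?_⟩⟩
  · rintro ⟨p, hp, hpx⟩
    refine ⟨E.symm p, isWeightedHomogeneous_algHom (E := E.symm.toAlgHom) hE' hp, ?_⟩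
    apply (Ideal.quotientEquivAlg (relIdeal T) (relIdeal S) E hI).injective
    rw [← hpx]
    change Ideal.Quotient.mk _ (E (E.symm p)) = _
    rw [E.apply_symm_apply]
    rfl
  · rintro ⟨p, hp, rfl⟩
    exact ⟨E p, isWeightedHomogeneous_algHom (E := E.toAlgHom) hE hp, rfl⟩

theorem Sim.submatrix {n : ℕ} {T : Matrix (Fin n) (Fin n) F} (hT : IsSLTM T)
    (σ : Equiv.Perm (Fin n)) (hS : IsSLTM (T.submatrix σ σ)) : Sim T (T.submatrix σ σ) := by
  have key (k : Fin n) : rename σ (rel (T.submatrix σ σ) k) = rel T (σ k) := by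
    simp only [rel, rowForm, map_sub, map_mul, map_pow, map_sum, rename_X, rename_C,
      Matrix.submatrix_apply]
    rw [Equiv.sum_comp σ (fun j => C (T (σ k) j) * X j)]
  refine (sim_of_algEquiv hS hT (renameEquiv F σ) ?_ ?_ ?_ ?_).symm
  · intro i
    simpa using isWeightedHomogeneous_X F (fun _ : Fin n => 2) (σ i)
  · intro i
    simpa using isWeightedHomogeneous_X F (fun _ : Fin n => 2) (σ.symm i)
  · intro k
    rw [renameEquiv_apply, key]
    exact hT.rel_mem _
  · intro k
    have : rel T k = renameEquiv F σ (rel (T.submatrix σ σ) (σ.symm k)) := by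
      rw [renameEquiv_apply, key, σ.apply_symm_apply]
    rw [this, AlgEquiv.symm_apply_apply]
    exact hS.rel_mem _

/-! ### Removing a leader by completing the square -/

/-- The elementary substitution `X_r ↦ X_r + a X_c`. -/
noncomputable def shearHom {n : ℕ} (r c : Fin n) (a : F) :
    MvPolynomial (Fin n) F →ₐ[F] MvPolynomial (Fin n) F :=
  aeval fun k => if k = r then X r + C a * X c else X k

theorem shearHom_X_self {n : ℕ} (r c : Fin n) (a : F) :
    shearHom r c a (X r) = X r + C a * X c := by
  simp [shearHom]

theorem shearHom_X_of_ne {n : ℕ} {r k : Fin n} (h : k ≠ r) (c : Fin n) (a : F) :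
    shearHom r c a (X k) = X k := by
  simp [shearHom, h]

theorem shearHom_comp {n : ℕ} {r c : Fin n} (h : c ≠ r) {a b : F} (hab : a + b = 0) :
    (shearHom r c a).comp (shearHom r c b) = AlgHom.id F _ := by
  ext1 k
  by_cases hk : k = r
  · subst hk
    have hC : (C a + C b : MvPolynomial (Fin n) F) = 0 := by rw [← C_add, hab, C_0]
    rw [AlgHom.comp_apply, shearHom_X_self, map_add, map_mul, shearHom_X_self, shearHom_X_of_ne h,
      ← algebraMap_eq, AlgHom.commutes, algebraMap_eq, AlgHom.id_apply]
    linear_combination X c * hC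
  · rw [AlgHom.comp_apply, shearHom_X_of_ne hk, shearHom_X_of_ne hk, AlgHom.id_apply]

theorem isWeightedHomogeneous_shearHom_X {n : ℕ} (r c : Fin n) (a : F) (i : Fin n) :
    IsWeightedHomogeneous (fun _ : Fin n => 2) (shearHom r c a (X i)) 2 := by
  by_cases h : i = r
  · subst h
    rw [shearHom_X_self]
    exact (isWeightedHomogeneous_X F _ i).add ((isWeightedHomogeneous_X F _ c).C_mul a)
  · rw [shearHom_X_of_ne h]
    exact isWeightedHomogeneous_X F _ i

/-- The elementary substitution as an automorphism of the polynomial ring. -/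
noncomputable def shearEquiv {n : ℕ} {r c : Fin n} (h : c ≠ r) (a : F) :
    MvPolynomial (Fin n) F ≃ₐ[F] MvPolynomial (Fin n) F :=
  AlgEquiv.ofAlgHom (shearHom r c a) (shearHom r c (-a)) (shearHom_comp h (by simp))
    (shearHom_comp h (by simp))

/-- The matrix obtained from `T` by the substitution that removes a leader `t_{rc}` all of whose
`Δ^{(2)}_{i,c,r}` vanish. -/
def removeLeader {n : ℕ} (T : Matrix (Fin n) (Fin n) F) (r c : Fin n) :
    Matrix (Fin n) (Fin n) F :=
  fun k j => if j = c then (if k = r then 0 else T k c + T r c / 2 * T k r) else T k j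

theorem removeLeader_of_ne_col {n : ℕ} (T : Matrix (Fin n) (Fin n) F) (r c : Fin n) (k : Fin n)
    {j : Fin n} (h : j ≠ c) : removeLeader T r c k j = T k j := by
  simp [removeLeader, h]

theorem removeLeader_leader {n : ℕ} (T : Matrix (Fin n) (Fin n) F) (r c : Fin n) :
    removeLeader T r c r c = 0 := by
  simp [removeLeader]

theorem removeLeader_col {n : ℕ} (T : Matrix (Fin n) (Fin n) F) (r c : Fin n) {k : Fin n}
    (h : k ≠ r) : removeLeader T r c k c = T k c + T r c / 2 * T k r := by
  simp [removeLeader, h]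

theorem IsSLTM.lt_of_ne_zero {n : ℕ} {T : Matrix (Fin n) (Fin n) F} (hT : IsSLTM T) {i j : Fin n}
    (h : T i j ≠ 0) : j < i := by
  by_contra hij
  exact h (hT i j (not_lt.1 hij))

theorem removeLeader_of_lt {n : ℕ} {T : Matrix (Fin n) (Fin n) F} (hT : IsSLTM T) {r c k : Fin n}
    (h : k < r) (j : Fin n) : removeLeader T r c k j = T k j := by
  by_cases hj : j = c
  · rw [hj, removeLeader_col T r c h.ne, hT k r h.le, mul_zero, add_zero]
  · exact removeLeader_of_ne_col T r c k hj

theorem IsSLTM.removeLeader {n : ℕ} {T : Matrix (Fin n) (Fin n) F} (hT : IsSLTM T) {r c : Fin n}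
    (hcr : c < r) : IsSLTM (removeLeader T r c) := by
  intro i j hij
  by_cases hj : j = c
  · subst hj
    rw [removeLeader_of_lt hT (hij.trans_lt hcr), hT i j hij]
  · rw [removeLeader_of_ne_col T r c i hj, hT i j hij]

theorem rowForm_removeLeader_self {n : ℕ} (T : Matrix (Fin n) (Fin n) F) (r c : Fin n) :
    rowForm (removeLeader T r c) r = rowForm T r - C (T r c) * X c := by
  rw [rowForm, rowForm, ← Finset.sum_erase_add _ _ (Finset.mem_univ c),
    ← Finset.sum_erase_add Finset.univ (fun j => C (T r j) * X j) (Finset.mem_univ c),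
    removeLeader_leader, C_0, zero_mul, add_zero, add_sub_cancel_right]
  exact Finset.sum_congr rfl fun j hj => by
    rw [removeLeader_of_ne_col T r c r (Finset.ne_of_mem_erase hj)]

theorem rowForm_removeLeader_of_ne {n : ℕ} (T : Matrix (Fin n) (Fin n) F) (r c : Fin n)
    {k : Fin n} (hk : k ≠ r) :
    rowForm (removeLeader T r c) k = rowForm T k + C (T r c / 2 * T k r) * X c := by
  rw [rowForm, rowForm, ← Finset.sum_erase_add _ _ (Finset.mem_univ c),
    ← Finset.sum_erase_add Finset.univ (fun j => C (T k j) * X j) (Finset.mem_univ c),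
    removeLeader_col T r c hk, C_add, add_mul, add_assoc]
  congr 1
  exact Finset.sum_congr rfl fun j hj => by
    rw [removeLeader_of_ne_col T r c k (Finset.ne_of_mem_erase hj)]

theorem shearHom_rowForm {n : ℕ} (T : Matrix (Fin n) (Fin n) F) (r c k : Fin n) (a : F) :
    shearHom r c a (rowForm T k) = rowForm T k + C (a * T k r) * X c := by
  have h (j : Fin n) : shearHom r c a (C (T k j) * X j) =
      C (T k j) * X j + if j = r then C (a * T k r) * X c else 0 := by
    rw [map_mul, ← algebraMap_eq, AlgHom.commutes, algebraMap_eq]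
    split_ifs with hj
    · subst hj
      rw [shearHom_X_self, C_mul]
      ring
    · rw [shearHom_X_of_ne hj, add_zero]
  rw [rowForm, map_sum, Finset.sum_congr rfl fun j _ => h j, Finset.sum_add_distrib,
    Finset.sum_ite_eq' _ _ _, if_pos (Finset.mem_univ _)]

/-- The summand `t_{rc}/2 * t_{kr}` added in column `c` cancels the term in `X_c` that the image of
`X_r` brings into the form of row `k`. -/
theorem shearHom_rel_of_ne {n : ℕ} (T : Matrix (Fin n) (Fin n) F) {r c k : Fin n}
    (hcr : c < r) (hk : k ≠ r) :
    shearHom r c (-(T r c / 2)) (rel (removeLeader T r c) k) = rel T k := by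
  have hX : shearHom r c (-(T r c / 2)) (X c) = X c := shearHom_X_of_ne hcr.ne c _
  rw [rel, map_sub, map_mul, map_pow, shearHom_X_of_ne hk, shearHom_rowForm,
    removeLeader_of_ne_col T r c k hcr.ne', rowForm_removeLeader_of_ne T r c hk, rel]
  simp only [C_mul, C_neg]
  ring

/-- The vanishing of all `Δ^{(2)}_{i,c,r}` means that row `r` without its leader is `-(t_{rc}/2)`
times row `c`. The terms left over after completing the square therefore form a multiple of the
relation of index `c`. -/
theorem shearHom_rel_self {n : ℕ} {T : Matrix (Fin n) (Fin n) F} (h2 : (2 : F) ≠ 0)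
    (hT : IsSLTM T) {r c : Fin n} (hcr : c < r) (hz : ∀ j, c < j → T r j = 0)
    (hΔ : ∀ i, i < c → Delta 2 T i c r = 0) :
    shearHom r c (-(T r c / 2)) (rel (removeLeader T r c) r) =
      rel T r + C ((T r c / 2) ^ 2) * rel T c := by
  have hsum : rowForm T r - C (T r c) * X c + C (T r c / 2) * rowForm T c = 0 := by
    rw [← rowForm_removeLeader_self, rowForm, rowForm, Finset.mul_sum, ← Finset.sum_add_distrib]
    refine Finset.sum_eq_zero fun j _ => ?_
    rw [← mul_assoc, ← C_mul, ← add_mul, ← C_add]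
    convert zero_mul _
    rw [← C_0]
    congr 1
    rcases lt_trichotomy j c with hj | hj | hj
    · have := hΔ j hj
      rw [Delta] at this
      rw [removeLeader_of_ne_col T r c r hj.ne]
      field_simp
      linear_combination this
    · subst hj
      rw [removeLeader_leader, hT j j le_rfl, mul_zero, add_zero]
    · rw [removeLeader_of_ne_col T r c r hj.ne', hz j hj, hT c j hj.le, mul_zero, add_zero]
  have hC : C (T r c) = (2 * C (T r c / 2) : MvPolynomial (Fin n) F) := by
    rw [show (2 : MvPolynomial (Fin n) F) = C 2 from (map_ofNat C 2).symm, ← C_mul]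
    congr 1
    field_simp
  rw [rel, map_sub, map_mul, map_pow, shearHom_X_self, shearHom_rowForm,
    removeLeader_of_ne_col T r c r hcr.ne', hT r r le_rfl, mul_zero, C_0, zero_mul, add_zero,
    rowForm_removeLeader_self, rel, rel, C_neg, C_pow]
  rw [hC] at hsum ⊢
  linear_combination C (T r c / 2) * X c * hsum

theorem Sim.removeLeader {n : ℕ} {T : Matrix (Fin n) (Fin n) F} (h2 : (2 : F) ≠ 0)
    (hT : IsSLTM T) {r c : Fin n} (hcr : c < r) (hz : ∀ j, c < j → T r j = 0)
    (hΔ : ∀ i, i < c → Delta 2 T i c r = 0) : Sim T (removeLeader T r c) := by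
  have hS := hT.removeLeader (r := r) hcr
  have hE (p) : shearEquiv hcr.ne (-(T r c / 2)) p = shearHom r c (-(T r c / 2)) p := rfl
  have hk {k : Fin n} (hk : k ≠ r) := shearHom_rel_of_ne T hcr hk
  have hr := shearHom_rel_self h2 hT hcr hz hΔ
  refine (sim_of_algEquiv hS hT (shearEquiv hcr.ne (-(T r c / 2)))
    (isWeightedHomogeneous_shearHom_X r c _) (isWeightedHomogeneous_shearHom_X r c _) ?_ ?_).symm
  · intro k
    rw [hE]
    by_cases h : k = r
    · rw [h, hr]
      exact add_mem (hT.rel_mem r) (Ideal.mul_mem_left _ _ (hT.rel_mem c))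
    · rw [hk h]
      exact hT.rel_mem k
  · intro k
    by_cases h : k = r
    · have : rel T r = shearEquiv hcr.ne (-(T r c / 2)) (rel (SLTM.removeLeader T r c) r -
          C ((T r c / 2) ^ 2) * rel (SLTM.removeLeader T r c) c) := by
        rw [map_sub, map_mul, hE (rel _ r), hE (rel _ c), hr, hk hcr.ne, ← algebraMap_eq,
          AlgEquiv.commutes, algebraMap_eq, add_sub_cancel_right]
      rw [h, this, AlgEquiv.symm_apply_apply]
      exact sub_mem (hS.rel_mem r) (Ideal.mul_mem_left _ _ (hS.rel_mem c))
    · rw [← hk h, ← hE, AlgEquiv.symm_apply_apply]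
      exact hS.rel_mem k

/-! ### Leader columns and the descent to 1-REF -/

variable [DecidableEq F] {n : ℕ}

theorem succ_le_leaderCol {T : Matrix (Fin n) (Fin n) F} {r j : Fin n} (h : T r j ≠ 0) :
    (j : ℕ) + 1 ≤ leaderCol T r :=
  Finset.le_sup (f := fun j : Fin n => (j : ℕ) + 1) (by simp [h])

theorem leaderCol_le_iff {T : Matrix (Fin n) (Fin n) F} {r : Fin n} {m : ℕ} :
    leaderCol T r ≤ m ↔ ∀ j, T r j ≠ 0 → (j : ℕ) + 1 ≤ m := by
  simp [leaderCol]

theorem IsSLTM.leaderCol_le {T : Matrix (Fin n) (Fin n) F} (hT : IsSLTM T) (r : Fin n) :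
    leaderCol T r ≤ r :=
  leaderCol_le_iff.2 fun _ hj => hT.lt_of_ne_zero hj

theorem IsLeader.leaderCol_eq {T : Matrix (Fin n) (Fin n) F} {r c : Fin n} (h : IsLeader T r c) :
    leaderCol T r = c + 1 := by
  refine le_antisymm (leaderCol_le_iff.2 fun j hj => ?_) (succ_le_leaderCol h.1)
  by_contra hlt
  exact hj (h.2 j (by rw [Fin.lt_def]; omega))

theorem leaderCol_eq_zero_iff {T : Matrix (Fin n) (Fin n) F} {r : Fin n} :
    leaderCol T r = 0 ↔ ∀ j, T r j = 0 := by
  rw [← Nat.le_zero, leaderCol_le_iff]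
  refine forall_congr' fun j => ⟨fun h => ?_, fun h h' => absurd h h'⟩
  by_contra h'
  exact absurd (h h') (by omega)

theorem exists_isLeader {T : Matrix (Fin n) (Fin n) F} {r : Fin n} (h : leaderCol T r ≠ 0) :
    ∃ c, IsLeader T r c := by
  have hne : (Finset.univ.filter fun j : Fin n => T r j ≠ 0).Nonempty := by
    rw [Finset.nonempty_iff_ne_empty]
    intro he
    exact h (by rw [leaderCol, he]; rfl)
  obtain ⟨c, hc, hmax⟩ := Finset.exists_max_image _ id hne
  simp only [Finset.mem_filter, Finset.mem_univ, true_and, id] at hc hmax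
  refine ⟨c, hc, fun j hj => ?_⟩
  by_contra hj'
  exact absurd (hmax j hj') (not_le.2 hj)

theorem leaderCol_congr {T S : Matrix (Fin n) (Fin n) F} {r : Fin n} (h : ∀ j, T r j = S r j) :
    leaderCol T r = leaderCol S r := by
  simp only [leaderCol, h]

theorem monotone_of_step {f : Fin n → ℕ}
    (h : ∀ r r' : Fin n, (r' : ℕ) = r + 1 → f r ≤ f r') : Monotone f := by
  intro a b hab
  obtain ⟨b, hb⟩ := b
  induction b with
  | zero =>
    have : a = ⟨0, hb⟩ := by ext; simpa [Fin.le_def] using hab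
    rw [this]
  | succ b ih =>
    rcases hab.eq_or_lt with he | hlt
    · rw [he]
    · exact (ih (by omega) (by simp only [Fin.lt_def, Fin.le_def] at hlt ⊢; omega)).trans
        (h _ _ rfl)

/-- With `c_r = 0` for zero rows, conditions (1) and (3) together amount to monotonicity of `c_r`;
the next lemma but one is the converse used by the descent. -/
theorem IsFirstREF.monotone_leaderCol {T : Matrix (Fin n) (Fin n) F} (h : IsFirstREF T) :
    Monotone (leaderCol T) := by
  refine monotone_of_step fun r r' hr => ?_
  by_cases h0 : leaderCol T r = 0
  · omega
  obtain ⟨c, hc⟩ := exists_isLeader h0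
  by_cases h0' : leaderCol T r' = 0
  · have := h.zero_above r' r (leaderCol_eq_zero_iff.1 h0') ⟨c, hc.1⟩
    rw [Fin.lt_def] at this
    omega
  obtain ⟨c', hc'⟩ := exists_isLeader h0'
  rw [hc.leaderCol_eq, hc'.leaderCol_eq]
  have := h.leader_mono r r' c c' hr hc hc'
  rw [Fin.le_def] at this
  omega

theorem isFirstREF_of_monotone {T : Matrix (Fin n) (Fin n) F} (h : Monotone (leaderCol T))
    (hΔ : ∀ r c, IsLeader T r c → ∃ i, i < c ∧ Delta 2 T i c r ≠ 0) : IsFirstREF T := by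
  refine ⟨fun r r' hr ⟨j, hj⟩ => ?_, hΔ, fun r r' c c' hr hc hc' => ?_⟩
  · by_contra hlt
    have := h (not_lt.1 hlt)
    have := succ_le_leaderCol hj
    have := leaderCol_eq_zero_iff.2 hr
    omega
  · have := h (show r ≤ r' by rw [Fin.le_def]; omega)
    rw [hc.leaderCol_eq, hc'.leaderCol_eq] at this
    rw [Fin.le_def]
    omega

theorem toLex_lt_of {f g : Fin n → ℕ} (r : Fin n) (h : ∀ k, k < r → f k = g k) (hr : f r < g r) :
    toLex f < toLex g :=
  ⟨r, h, hr⟩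

theorem IsSLTM.exists_swap_lt {T : Matrix (Fin n) (Fin n) F} (hT : IsSLTM T) {r r' : Fin n}
    (hr : (r' : ℕ) = r + 1) (hlt : leaderCol T r' < leaderCol T r) :
    ∃ S : Matrix (Fin n) (Fin n) F, IsSLTM S ∧ Sim T S ∧
      toLex (leaderCol S) < toLex (leaderCol T) := by
  have hle := hT.leaderCol_le r
  set σ := Equiv.swap r r' with hσ
  have hσr : σ r = r' := Equiv.swap_apply_left _ _
  have hσr' : σ r' = r := Equiv.swap_apply_right _ _
  have hσk (k : Fin n) (h : k ≠ r) (h' : k ≠ r') : σ k = k := Equiv.swap_apply_of_ne_of_ne h h'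
  -- Only `t_{r'r}` could cross the diagonal, and it vanishes because `c_{r'} < c_r ≤ r`, where the
  -- index `r` counts from `0`.
  have hS : IsSLTM (T.submatrix σ σ) := by
    intro i j hij
    rw [Matrix.submatrix_apply]
    by_contra hne
    have h1 := hT.lt_of_ne_zero hne
    have h2 := succ_le_leaderCol hne
    simp only [Fin.lt_def, Fin.le_def] at h1 hij
    by_cases hi : i = r
    · rw [hi, hσr] at h1 h2
      by_cases hj : j = r'
      · rw [hj, hσr'] at h2
        omega
      · by_cases hj' : j = r
        · rw [hj', hσr] at h1
          omega
        · rw [hσk j hj' hj] at h2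
          rw [hi] at hij
          omega
    · by_cases hi' : i = r'
      · rw [hi', hσr'] at h1
        by_cases hj : j = r'
        · rw [hj, hσr'] at h1
          omega
        · by_cases hj' : j = r
          · rw [hj', hσr] at h1
            omega
          · rw [hσk j hj' hj] at h1
            rw [hi'] at hij
            omega
      · rw [hσk i hi hi'] at h1
        by_cases hj : j = r'
        · rw [hj, hσr'] at h1
          have : (i : ℕ) ≠ r' := fun h => hi' (Fin.ext h)
          rw [hj] at hij
          omega
        · by_cases hj' : j = r
          · rw [hj', hσr] at h1
            rw [hj'] at hij
            omega
          · rw [hσk j hj' hj] at h1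
            omega
  refine ⟨T.submatrix σ σ, hS, Sim.submatrix hT σ hS, toLex_lt_of r (fun k hk => ?_) ?_⟩
  · refine leaderCol_congr fun j => ?_
    have hk' : k ≠ r' := fun h => by rw [h, Fin.lt_def] at hk; omega
    rw [Matrix.submatrix_apply, hσk k hk.ne hk']
    rw [Fin.lt_def] at hk
    by_cases hj : j = r
    · rw [hj, hσr, hT k r' (by rw [Fin.le_def]; omega), hT k r (by rw [Fin.le_def]; omega)]
    · by_cases hj' : j = r'
      · rw [hj', hσr', hT k r' (by rw [Fin.le_def]; omega), hT k r (by rw [Fin.le_def]; omega)]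
      · rw [hσk j hj hj']
  · refine lt_of_le_of_lt (leaderCol_le_iff.2 fun j hj => ?_) hlt
    rw [Matrix.submatrix_apply, hσr] at hj
    have h1 := succ_le_leaderCol hj
    by_cases hj1 : j = r
    · rw [hj1, hσr] at h1
      omega
    · by_cases hj2 : j = r'
      · rw [hj2, hσr'] at h1
        omega
      · rwa [hσk j hj1 hj2] at h1

theorem IsSLTM.exists_removeLeader_lt {T : Matrix (Fin n) (Fin n) F} (h2 : (2 : F) ≠ 0)
    (hT : IsSLTM T) {r c : Fin n} (hc : IsLeader T r c)
    (hΔ : ∀ i, i < c → Delta 2 T i c r = 0) :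
    ∃ S : Matrix (Fin n) (Fin n) F, IsSLTM S ∧ Sim T S ∧
      toLex (leaderCol S) < toLex (leaderCol T) := by
  have hcr := hT.lt_of_ne_zero hc.1
  refine ⟨_, hT.removeLeader hcr, Sim.removeLeader h2 hT hcr hc.2 hΔ,
    toLex_lt_of r (fun k hk => leaderCol_congr (removeLeader_of_lt hT hk)) ?_⟩
  rw [hc.leaderCol_eq, Nat.lt_succ_iff]
  refine leaderCol_le_iff.2 fun j hj => ?_
  by_contra hlt
  by_cases hjc : j = c
  · rw [hjc] at hj
    exact hj (removeLeader_leader T r c)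
  · rw [removeLeader_of_ne_col T r c r hjc] at hj
    have : (j : ℕ) ≠ c := fun h => hjc (Fin.ext h)
    exact hj (hc.2 j (by rw [Fin.lt_def]; omega))

theorem IsSLTM.exists_isFirstREF {T : Matrix (Fin n) (Fin n) F} (h2 : (2 : F) ≠ 0)
    (hT : IsSLTM T) :
    ∃ R : Matrix (Fin n) (Fin n) F, IsSLTM R ∧ IsFirstREF R ∧ Sim T R := by
  -- The lexicographic order on functions `Fin n → ℕ` is well founded, so the class of `T` contains
  -- a matrix that neither move can lower.
  have hwf : WellFounded fun R S : Matrix (Fin n) (Fin n) F =>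
      toLex (leaderCol R) < toLex (leaderCol S) :=
    InvImage.wf (fun R : Matrix (Fin n) (Fin n) F => toLex (leaderCol R)) wellFounded_lt
  obtain ⟨R, ⟨hR, hTR⟩, hmin⟩ := hwf.has_min
    {R : Matrix (Fin n) (Fin n) F | IsSLTM R ∧ Sim T R} ⟨T, hT, Sim.refl T⟩
  refine ⟨R, hR, isFirstREF_of_monotone (monotone_of_step fun r r' hr => ?_) fun r c hc => ?_, hTR⟩
  · by_contra hlt
    obtain ⟨S, hS, hRS, hlt⟩ := hR.exists_swap_lt hr (not_le.1 hlt)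
    exact hmin S ⟨hS, hTR.trans hRS⟩ hlt
  · by_contra! hΔ
    obtain ⟨S, hS, hRS, hlt⟩ := hR.exists_removeLeader_lt h2 hc hΔ
    exact hmin S ⟨hS, hTR.trans hRS⟩ hlt

end Similarity

/-! ### The invariant filtration of the component of degree 2 -/

section Invariant

variable {F : Type*} [Field F] {n : ℕ}

/-- The generator `X_i` of `A(T)`. -/
noncomputable def gen (T : Matrix (Fin n) (Fin n) F) (i : Fin n) : NilAlg T :=
  Ideal.Quotient.mk (relIdeal T) (X i)

theorem IsSLTM.gen_mul_self {T : Matrix (Fin n) (Fin n) F} (hT : IsSLTM T) (k : Fin n) :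
    gen T k * gen T k = (∑ j, T k j • gen T j) * gen T k := by
  have h := Ideal.Quotient.eq_zero_iff_mem.2 (hT.rel_mem k)
  rw [rel, map_sub, map_pow, map_mul, sub_eq_zero, sq, rowForm, map_sum] at h
  refine h.trans ?_
  congr 1
  refine Finset.sum_congr rfl fun j _ => ?_
  rw [← smul_eq_C_mul]
  rfl

theorem exists_eq_single_of_degree_eq_one {σ : Type*} {m : σ →₀ ℕ} (h : m.degree = 1) :
    ∃ i, m = Finsupp.single i 1 := by
  have hm : m ≠ 0 := by
    rintro rfl
    simp at h
  obtain ⟨i, hi⟩ := Finsupp.ne_iff.1 hm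
  obtain ⟨l, rfl⟩ := exists_add_of_le
    (Finsupp.single_le_iff.2 (Nat.one_le_iff_ne_zero.2 hi) : Finsupp.single i 1 ≤ m)
  rw [map_add, Finsupp.degree_single, Nat.add_eq_left, Finsupp.degree_eq_zero_iff] at h
  exact ⟨i, by rw [h, add_zero]⟩

theorem component_two_eq (T : Matrix (Fin n) (Fin n) F) :
    component T 2 = Submodule.span F (Set.range (gen T)) := by
  apply le_antisymm
  · rintro _ ⟨p, hp, rfl⟩
    replace hp : IsWeightedHomogeneous (fun _ : Fin n => 2) p 2 := hp
    induction hp using IsWeightedHomogeneous.induction_on with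
    | zero => rw [map_zero]; exact zero_mem _
    | add p q hp hq ihp ihq =>
      rw [map_add]
      exact add_mem ihp ihq
    | monomial m r hm =>
      have hdeg : m.degree = 1 := by
        have : m.degree * 2 = 2 := by
          rw [Finsupp.weight_apply, Finsupp.sum_fintype _ _ (by simp)] at hm
          rw [Finsupp.degree_eq_sum, Finset.sum_mul]
          exact hm
        omega
      obtain ⟨i, rfl⟩ := exists_eq_single_of_degree_eq_one hdeg
      have : monomial (Finsupp.single i 1) r = r • (X i : MvPolynomial (Fin n) F) := by
        rw [X, smul_monomial, smul_eq_mul, mul_one]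
      rw [this, map_smul]
      exact Submodule.smul_mem _ _ (Submodule.subset_span ⟨i, rfl⟩)
  · rw [Submodule.span_le]
    rintro _ ⟨i, rfl⟩
    exact ⟨X i, isWeightedHomogeneous_X F _ i, rfl⟩

/-- The filtration of the component of degree `2` by `U_0 = 0` and
`U_{k+1} = span {v | v² ∈ U_k U_k}`. -/
noncomputable def sqFiltration (T : Matrix (Fin n) (Fin n) F) : ℕ → Submodule F (NilAlg T)
  | 0 => ⊥
  | k + 1 => Submodule.span F {v | v ∈ component T 2 ∧ v * v ∈ sqFiltration T k * sqFiltration T k}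

theorem map_component {m : ℕ} {T : Matrix (Fin m) (Fin m) F} {S : Matrix (Fin n) (Fin n) F}
    {e : NilAlg T ≃ₐ[F] NilAlg S} (he : ∀ d x, e x ∈ component S d ↔ x ∈ component T d) (d : ℕ) :
    (component T d).map e.toLinearMap = component S d := by
  ext y
  constructor
  · rintro ⟨x, hx, rfl⟩
    exact (he d x).2 hx
  · intro hy
    exact ⟨e.symm y, (he d _).1 (by rwa [e.apply_symm_apply]), e.apply_symm_apply y⟩

/-- The filtration is built from the component of degree 2 and products alone. -/
theorem map_sqFiltration {m : ℕ} {T : Matrix (Fin m) (Fin m) F} {S : Matrix (Fin n) (Fin n) F}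
    {e : NilAlg T ≃ₐ[F] NilAlg S} (he : ∀ d x, e x ∈ component S d ↔ x ∈ component T d) (k : ℕ) :
    (sqFiltration T k).map e.toLinearMap = sqFiltration S k := by
  induction k with
  | zero => exact Submodule.map_bot _
  | succ k ih =>
    have hmul : (sqFiltration T k * sqFiltration T k).map e.toLinearMap =
        sqFiltration S k * sqFiltration S k := by
      rw [← ih]
      exact Submodule.map_mul _ _ e.toAlgHom
    have hiff (x : NilAlg T) : e x ∈ sqFiltration S k * sqFiltration S k ↔
        x ∈ sqFiltration T k * sqFiltration T k := by
      rw [← hmul]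
      exact Function.Injective.mem_set_image e.injective
    rw [sqFiltration, sqFiltration, Submodule.map_span]
    congr 1
    ext y
    constructor
    · rintro ⟨x, ⟨hx, hx'⟩, rfl⟩
      refine ⟨(he 2 x).2 hx, ?_⟩
      have := (hiff (x * x)).2 hx'
      rwa [map_mul] at this
    · rintro ⟨hy, hy'⟩
      refine ⟨e.symm y, ⟨(he 2 _).1 (by rwa [e.apply_symm_apply]), (hiff _).1 ?_⟩,
        e.apply_symm_apply y⟩
      rwa [map_mul, e.apply_symm_apply]

theorem Sim.finrank_sqFiltration {m : ℕ} {T : Matrix (Fin m) (Fin m) F}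
    {S : Matrix (Fin n) (Fin n) F} (h : Sim T S) (k : ℕ) :
    Module.finrank F (sqFiltration T k) = Module.finrank F (sqFiltration S k) := by
  obtain ⟨e, he⟩ := h
  rw [← map_sqFiltration he k]
  exact (LinearEquiv.finrank_map_eq e.toLinearEquiv _).symm

theorem Sim.finrank_component {m : ℕ} {T : Matrix (Fin m) (Fin m) F}
    {S : Matrix (Fin n) (Fin n) F} (h : Sim T S) (d : ℕ) :
    Module.finrank F (component T d) = Module.finrank F (component S d) := by
  obtain ⟨e, he⟩ := h
  rw [← map_component he d]
  exact (LinearEquiv.finrank_map_eq e.toLinearEquiv _).symm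

/-! ### Coordinate functionals in polynomial degrees 1 and 2 -/

theorem coeff_mul_of_isHomogeneous {σ R : Type*} [CommSemiring R] {p g : MvPolynomial σ R} {d : ℕ}
    (hg : g.IsHomogeneous d) {m : σ →₀ ℕ} (hm : m.degree ≤ d) :
    coeff m (p * g) = coeff 0 p * coeff m g := by
  classical
  rw [coeff_mul]
  refine Finset.sum_eq_single (0, m) (fun b hb hne => ?_) fun h => ?_
  · rw [Finset.HasAntidiagonal.mem_antidiagonal] at hb
    by_contra h0
    have hd : b.2.degree = d := by
      by_contra hd
      exact h0 (by rw [hg.coeff_eq_zero hd, mul_zero])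
    have hsum : b.1.degree + b.2.degree = m.degree := by rw [← hb, map_add]
    have hb1 : b.1 = 0 := by
      rw [← Finsupp.degree_eq_zero_iff]
      omega
    rw [hb1, zero_add] at hb
    exact hne (Prod.ext hb1 hb)
  · exact absurd (by simp) h

theorem isHomogeneous_rel (T : Matrix (Fin n) (Fin n) F) (k : Fin n) :
    (rel T k).IsHomogeneous 2 := by
  refine ((isHomogeneous_X F k).pow 2).sub
    (IsHomogeneous.mul (m := 1) (n := 1) ?_ (isHomogeneous_X F k))
  exact IsHomogeneous.sum _ _ _ fun j _ => (isHomogeneous_X F j).C_mul _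

/-- Criterion for a functional to descend to `A(T)`. The relations are quadratic, so coefficients of
total degree at most 2 see only the constant term of a multiplier, which is hypothesis `h`. -/
theorem IsSLTM.functional_eq_zero {T : Matrix (Fin n) (Fin n) F} (hT : IsSLTM T)
    (φ : MvPolynomial (Fin n) F →ₗ[F] F)
    (h : ∀ p k, φ (p * rel T k) = coeff 0 p * φ (rel T k)) (h0 : ∀ k, φ (rel T k) = 0)
    {p : MvPolynomial (Fin n) F} (hp : p ∈ relIdeal T) : φ p = 0 := by
  rw [hT.relIdeal_eq] at hp
  induction hp using Submodule.span_induction with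
  | mem x hx => obtain ⟨k, rfl⟩ := hx; exact h0 k
  | zero => exact map_zero φ
  | add x y _ _ hx hy => rw [map_add, hx, hy, add_zero]
  | smul a x hx' _ =>
    -- That `φ x = 0` says nothing about `φ (a • x)`, so membership is unfolded a second time with
    -- `a` arbitrary.
    clear * - h h0 hx'
    induction hx' using Submodule.span_induction generalizing a with
    | mem x hx => obtain ⟨k, rfl⟩ := hx; rw [smul_eq_mul, h, h0, mul_zero]
    | zero => rw [smul_zero, map_zero]
    | add x y _ _ hx hy => rw [smul_add, map_add, hx, hy, add_zero]
    | smul b x _ hx => rw [smul_smul]; exact hx _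

theorem coeff_X_mul_X (m : Fin n →₀ ℕ) (a b : Fin n) :
    coeff m (X a * X b : MvPolynomial (Fin n) F) =
      if Finsupp.single a 1 + Finsupp.single b 1 = m then 1 else 0 := by
  rw [X, X, monomial_mul, one_mul, coeff_monomial]

theorem single_add_single_eq_iff {a b i j : Fin n} :
    (Finsupp.single a 1 + Finsupp.single b 1 : Fin n →₀ ℕ) =
      Finsupp.single i 1 + Finsupp.single j 1 ↔ (a = i ∧ b = j) ∨ (a = j ∧ b = i) := by
  constructor
  · intro h
    have ha := DFunLike.congr_fun h a
    have hb := DFunLike.congr_fun h b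
    have hi := DFunLike.congr_fun h i
    have hj := DFunLike.congr_fun h j
    simp only [Finsupp.add_apply, Finsupp.single_apply] at ha hb hi hj
    grind
  · rintro (⟨rfl, rfl⟩ | ⟨rfl, rfl⟩)
    · rfl
    · exact add_comm _ _

/-- The coefficient at `X_i X_j`, `i < j`, of the normal form, as a functional on polynomials. -/
noncomputable def polyCoord (T : Matrix (Fin n) (Fin n) F) (i j : Fin n) :
    MvPolynomial (Fin n) F →ₗ[F] F :=
  lcoeff F (Finsupp.single i 1 + Finsupp.single j 1) +
    T j i • lcoeff F (Finsupp.single j 1 + Finsupp.single j 1)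

theorem polyCoord_apply (T : Matrix (Fin n) (Fin n) F) (i j : Fin n) (p : MvPolynomial (Fin n) F) :
    polyCoord T i j p = coeff (Finsupp.single i 1 + Finsupp.single j 1) p +
      T j i * coeff (Finsupp.single j 1 + Finsupp.single j 1) p := rfl

theorem polyCoord_X_mul_X (T : Matrix (Fin n) (Fin n) F) (i j a b : Fin n) :
    polyCoord T i j (X a * X b) = (if (a = i ∧ b = j) ∨ (a = j ∧ b = i) then 1 else 0) +
      if a = j ∧ b = j then T j i else 0 := by
  rw [polyCoord_apply, coeff_X_mul_X, coeff_X_mul_X]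
  simp only [single_add_single_eq_iff, or_self, mul_ite, mul_one, mul_zero]

/-- In the relation of index `j` the contribution `t_{ji}` of `X_j²` cancels that of `-t_{ji} X_i
X_j`; the other relations contribute nothing, by triangularity. -/
theorem IsSLTM.polyCoord_rel {T : Matrix (Fin n) (Fin n) F} (hT : IsSLTM T) {i j : Fin n}
    (hij : i < j) (k : Fin n) : polyCoord T i j (rel T k) = 0 := by
  rw [rel, rowForm, Finset.sum_mul, map_sub, map_sum, sq, polyCoord_X_mul_X]
  have h (l : Fin n) : polyCoord T i j (C (T k l) * X l * X k) =
      if l = i then (if k = j then T j i else 0) else 0 := by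
    rw [mul_assoc, ← smul_eq_C_mul, map_smul, polyCoord_X_mul_X, smul_eq_mul]
    by_cases hli : l = i
    · subst hli
      by_cases hkj : k = j
      · subst hkj
        simp [hij.ne]
      · simp [hkj, hij.ne]
    · by_cases hlj : l = j
      · subst hlj
        by_cases hki : k = i
        · subst hki
          simp [hT k l hij.le, hli]
        · by_cases hkl : k = l
          · subst hkl
            simp [hT k k le_rfl, hki]
          · simp [hki, hkl, hli]
      · simp [hli, hlj]
  rw [Finset.sum_congr rfl fun l _ => h l, Finset.sum_ite_eq' _ _ _, if_pos (Finset.mem_univ _)]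
  by_cases hkj : k = j
  · subst hkj
    simp [hij.ne']
  · simp [hkj]

theorem IsSLTM.exists_coord {T : Matrix (Fin n) (Fin n) F} (hT : IsSLTM T) {i j : Fin n}
    (hij : i < j) : ∃ φ : NilAlg T →ₗ[F] F, ∀ a b, φ (gen T a * gen T b) =
      (if (a = i ∧ b = j) ∨ (a = j ∧ b = i) then 1 else 0) + if a = j ∧ b = j then T j i else 0 := by
  have hle : (relIdeal T).restrictScalars F ≤ LinearMap.ker (polyCoord T i j) := by
    intro p hp
    rw [LinearMap.mem_ker]
    refine hT.functional_eq_zero _ (fun p k => ?_) (hT.polyCoord_rel hij) hp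
    have hd (a b : Fin n) : (Finsupp.single a 1 + Finsupp.single b 1 : Fin n →₀ ℕ).degree ≤ 2 := by
      simp
    rw [polyCoord_apply, polyCoord_apply, coeff_mul_of_isHomogeneous (isHomogeneous_rel T k) (hd _ _),
      coeff_mul_of_isHomogeneous (isHomogeneous_rel T k) (hd _ _)]
    ring
  exact ⟨((relIdeal T).restrictScalars F).liftQ (polyCoord T i j) hle,
    fun a b => polyCoord_X_mul_X T i j a b⟩

theorem IsSLTM.linearIndependent_gen {T : Matrix (Fin n) (Fin n) F} (hT : IsSLTM T) :
    LinearIndependent F (gen T) := by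
  have hex (i : Fin n) : ∃ φ : NilAlg T →ₗ[F] F, ∀ a, φ (gen T a) = if a = i then 1 else 0 := by
    have hd (k : Fin n) : coeff (Finsupp.single i 1) (rel T k) = 0 :=
      (isHomogeneous_rel T k).coeff_eq_zero (by simp)
    have hle : (relIdeal T).restrictScalars F ≤ LinearMap.ker (lcoeff F (Finsupp.single i 1)) := by
      intro p hp
      rw [LinearMap.mem_ker]
      exact hT.functional_eq_zero _ (fun p k => coeff_mul_of_isHomogeneous (isHomogeneous_rel T k)
        (by simp)) hd hp
    refine ⟨((relIdeal T).restrictScalars F).liftQ (lcoeff F (Finsupp.single i 1)) hle, fun a => ?_⟩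
    change coeff _ (X a) = _
    rw [coeff_X]
    simp [Finsupp.single_left_inj]
  choose φ hφ using hex
  rw [Fintype.linearIndependent_iff]
  intro g hg i
  have := congrArg (φ i) hg
  simpa [hφ] using this

theorem IsSLTM.finrank_component {T : Matrix (Fin n) (Fin n) F} (hT : IsSLTM T) :
    Module.finrank F (component T 2) = n := by
  rw [component_two_eq, finrank_span_eq_card hT.linearIndependent_gen, Fintype.card_fin]

theorem Sim.size_eq {m : ℕ} {T : Matrix (Fin m) (Fin m) F} {S : Matrix (Fin n) (Fin n) F}
    (h : Sim T S) (hT : IsSLTM T) (hS : IsSLTM S) : m = n := by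
  rw [← hT.finrank_component, ← hS.finrank_component, h.finrank_component]

/-! ### Coordinate flags and coefficients of squares -/

/-- The span of the generators of number (counted from `1`) less than `q`. -/
noncomputable def flag (T : Matrix (Fin n) (Fin n) F) (q : ℕ) : Submodule F (NilAlg T) :=
  Submodule.span F (gen T '' {j | (j : ℕ) + 1 < q})

theorem gen_mem_flag (T : Matrix (Fin n) (Fin n) F) {q : ℕ} {j : Fin n} (h : (j : ℕ) + 1 < q) :
    gen T j ∈ flag T q :=
  Submodule.subset_span ⟨j, h, rfl⟩

theorem flag_le_component (T : Matrix (Fin n) (Fin n) F) (q : ℕ) : flag T q ≤ component T 2 := by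
  rw [component_two_eq]
  exact Submodule.span_mono (Set.image_subset_range _ _)

theorem IsSLTM.finrank_flag {T : Matrix (Fin n) (Fin n) F} (hT : IsSLTM T) {q : ℕ} (hq : q ≤ n) :
    Module.finrank F (flag T (q + 1)) = q := by
  have : gen T '' {j | (j : ℕ) + 1 < q + 1} = Set.range (gen T ∘ Fin.castLE hq) := by
    ext x
    constructor
    · rintro ⟨j, hj, rfl⟩
      exact ⟨⟨j, by simpa using hj⟩, rfl⟩
    · rintro ⟨j, rfl⟩
      exact ⟨Fin.castLE hq j, by simp, rfl⟩
  rw [flag, this, finrank_span_eq_card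
    (hT.linearIndependent_gen.comp _ (Fin.castLE_injective hq)), Fintype.card_fin]

/-- The functional sees only products involving `X_j`, and `X_j` is not among the generators
spanning the flag. -/
theorem eq_zero_of_mem_flag_mul (T : Matrix (Fin n) (Fin n) F) {i j : Fin n}
    {φ : NilAlg T →ₗ[F] F} (hφ : ∀ a b, φ (gen T a * gen T b) =
      (if (a = i ∧ b = j) ∨ (a = j ∧ b = i) then 1 else 0) + if a = j ∧ b = j then T j i else 0)
    {q : ℕ} (hj : q ≤ (j : ℕ) + 1) {x : NilAlg T} (hx : x ∈ flag T q * flag T q) : φ x = 0 := by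
  have hle : flag T q * flag T q ≤ LinearMap.ker φ := by
    rw [flag, Submodule.span_mul_span, Submodule.span_le]
    rintro _ ⟨_, ⟨a, ha, rfl⟩, _, ⟨b, hb, rfl⟩, rfl⟩
    have hne (a : Fin n) (ha : (a : ℕ) + 1 < q) : a ≠ j := by
      rintro rfl
      omega
    change φ (gen T a * gen T b) = 0
    simp [hφ, hne a ha, hne b hb]
  exact hle hx

theorem coord_sq {T : Matrix (Fin n) (Fin n) F} {i j : Fin n} (hij : i < j)
    {φ : NilAlg T →ₗ[F] F} (hφ : ∀ a b, φ (gen T a * gen T b) =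
      (if (a = i ∧ b = j) ∨ (a = j ∧ b = i) then 1 else 0) + if a = j ∧ b = j then T j i else 0)
    (v : Fin n → F) : φ ((∑ a, v a • gen T a) * ∑ a, v a • gen T a) =
      v j * (2 * v i + v j * T j i) := by
  have h (a b : Fin n) : φ (v a • gen T a * v b • gen T b) =
      (if a = i then (if b = j then v i * v j else 0) else 0) +
      (if a = j then (if b = i then v i * v j else 0) else 0) +
      (if a = j then (if b = j then v j * v j * T j i else 0) else 0) := by
    rw [smul_mul_smul_comm, map_smul, hφ, smul_eq_mul]
    have := hij.ne
    grind
  simp only [Finset.sum_mul_sum, map_sum, h, Finset.sum_add_distrib, Finset.sum_ite_eq',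
    Finset.sum_ite_irrel, Finset.sum_const_zero, Finset.mem_univ, if_true]
  ring

end Invariant

/-! ### The filtration of a matrix in 1-REF -/

variable {F : Type*} [Field F] [DecidableEq F] {n : ℕ}

/-- The least element of `laterRows T q`, and `n + 1` if there is none. -/
def nextRow (T : Matrix (Fin n) (Fin n) F) (q : ℕ) : ℕ :=
  if h : (laterRows T q).Nonempty then (laterRows T q).min' h else n + 1

theorem mem_laterRows {T : Matrix (Fin n) (Fin n) F} {q m : ℕ} :
    m ∈ laterRows T q ↔ ∃ r : Fin n, (q < (r : ℕ) + 1 ∧ q ≤ leaderCol T r) ∧ (r : ℕ) + 1 = m := by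
  simp [laterRows]

theorem nextRow_le (T : Matrix (Fin n) (Fin n) F) (q : ℕ) : nextRow T q ≤ n + 1 := by
  unfold nextRow
  split_ifs with h
  · exact (lt_of_mem_laterRows (Finset.min'_mem _ h)).2.trans (Nat.le_succ n)
  · exact le_rfl

theorem lt_nextRow (T : Matrix (Fin n) (Fin n) F) {q : ℕ} (hq : q ≤ n) : q < nextRow T q := by
  unfold nextRow
  split_ifs with h
  · exact (lt_of_mem_laterRows (Finset.min'_mem _ h)).1
  · omega

/-- With `nextRow_le`, this makes the default value `n + 1` a fixed point, where orbits stay once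
the wall has ended. -/
theorem le_nextRow (T : Matrix (Fin n) (Fin n) F) {q : ℕ} (hq : q ≤ n + 1) : q ≤ nextRow T q := by
  rcases hq.lt_or_eq with h | rfl
  · exact (lt_nextRow T (by omega)).le
  · rw [nextRow, dif_neg]
    rintro ⟨m, hm⟩
    have := lt_of_mem_laterRows hm
    omega

/-- Row `q` itself is not in `laterRows T q`; triangularity handles it, and minimality of the next
row handles those strictly between. -/
theorem leaderCol_lt_of_lt_nextRow {T : Matrix (Fin n) (Fin n) F} (hT : IsSLTM T) {q : ℕ}
    {r : Fin n} (hq : q ≤ (r : ℕ) + 1) (hr : (r : ℕ) + 1 < nextRow T q) : leaderCol T r < q := by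
  rcases hq.eq_or_lt with rfl | hlt
  · exact Nat.lt_succ_of_le (hT.leaderCol_le r)
  · by_contra hge
    have hm : (r : ℕ) + 1 ∈ laterRows T q := mem_laterRows.2 ⟨r, ⟨hlt, not_lt.1 hge⟩, rfl⟩
    rw [nextRow, dif_pos ⟨_, hm⟩] at hr
    exact absurd (Finset.min'_le _ _ hm) (not_le.2 hr)

/-- Monotone leader columns carry the bound from the next row to all rows below it. -/
theorem le_leaderCol_of_nextRow_le {T : Matrix (Fin n) (Fin n) F} (hT : IsFirstREF T) {q : ℕ}
    {r : Fin n} (hr : nextRow T q ≤ (r : ℕ) + 1) : q ≤ leaderCol T r := by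
  unfold nextRow at hr
  split_ifs at hr with h
  · obtain ⟨s, ⟨-, hs⟩, hs'⟩ := mem_laterRows.1 (Finset.min'_mem _ h)
    exact hs.trans (hT.monotone_leaderCol (by rw [Fin.le_def]; omega))
  · have := r.isLt
    omega

/-- For `r ≥ q`, half the form of row `r` is an element `u` of the flag, and `X_r² = 2 u X_r` gives
`(X_r - u)² = u²`. Thus `X_r = (X_r - u) + u` is a sum of two admissible vectors. -/
theorem gen_mem_span_of_lt_nextRow {T : Matrix (Fin n) (Fin n) F} (h2 : (2 : F) ≠ 0)
    (hT : IsSLTM T) {q : ℕ} {r : Fin n} (hr : (r : ℕ) + 1 < nextRow T q) :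
    gen T r ∈ Submodule.span F {v | v ∈ component T 2 ∧ v * v ∈ flag T q * flag T q} := by
  have hsub {u : NilAlg T} (hu : u ∈ flag T q) :
      u ∈ Submodule.span F {v | v ∈ component T 2 ∧ v * v ∈ flag T q * flag T q} :=
    Submodule.subset_span ⟨flag_le_component T q hu, Submodule.mul_mem_mul hu hu⟩
  rcases lt_or_ge ((r : ℕ) + 1) q with hlt | hge
  · exact hsub (gen_mem_flag T hlt)
  set u : NilAlg T := (2 : F)⁻¹ • ∑ j, T r j • gen T j with hu
  have huq : u ∈ flag T q := by
    refine Submodule.smul_mem _ _ (Submodule.sum_mem _ fun j _ => ?_)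
    by_cases h0 : T r j = 0
    · rw [h0, zero_smul]
      exact zero_mem _
    · exact Submodule.smul_mem _ _ (gen_mem_flag T
        ((succ_le_leaderCol h0).trans_lt (leaderCol_lt_of_lt_nextRow hT hge hr)))
  have huu : gen T r * gen T r = (u + u) * gen T r := by
    rw [hT.gen_mul_self, hu, ← two_smul F, smul_smul, mul_inv_cancel₀ h2, one_smul]
  have hsq : (gen T r - u) * (gen T r - u) = u * u := by linear_combination huu
  have hv : gen T r - u ∈ Submodule.span F
      {v | v ∈ component T 2 ∧ v * v ∈ flag T q * flag T q} := by
    refine Submodule.subset_span ⟨sub_mem ?_ (flag_le_component T q huq), ?_⟩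
    · rw [component_two_eq]
      exact Submodule.subset_span ⟨r, rfl⟩
    · rw [hsq]
      exact Submodule.mul_mem_mul huq huq
  simpa using add_mem hv (hsub huq)

/-- Let `v_r ≠ 0` with `r` at or beyond the next row. The coefficients of `v²` at `X_i X_r` force `2
v_i = -v_r t_{ri}`, so `v_c ≠ 0` at the leader `c` of row `r`. As `c ≥ q`, those at `X_i X_c` vanish
too, and this yields `v_r Δ^{(2)}_{i,c,r} = 0` for all `i < c`, against condition (2). -/
theorem mem_flag_nextRow {T : Matrix (Fin n) (Fin n) F} (hT : IsSLTM T)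
    (hR : IsFirstREF T) {q : ℕ} (hq1 : 1 ≤ q) (hq : q ≤ n + 1) {x : NilAlg T} (hx : x ∈ component T 2)
    (hxx : x * x ∈ flag T q * flag T q) : x ∈ flag T (nextRow T q) := by
  rw [component_two_eq, Submodule.mem_span_range_iff_exists_fun] at hx
  obtain ⟨v, rfl⟩ := hx
  by_contra hmem
  have hne : (Finset.univ.filter fun a : Fin n => v a ≠ 0 ∧ nextRow T q ≤ (a : ℕ) + 1).Nonempty := by
    rw [Finset.nonempty_iff_ne_empty]
    intro he
    refine hmem (Submodule.sum_mem _ fun a _ => ?_)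
    by_cases h0 : v a = 0
    · rw [h0, zero_smul]
      exact zero_mem _
    · refine Submodule.smul_mem _ _ (gen_mem_flag T (not_le.1 fun h => ?_))
      exact Finset.notMem_empty a (he ▸ by simp [h0, h])
  -- Any element of the set would do; maximality is discarded.
  obtain ⟨r, hr, -⟩ := Finset.exists_max_image _ id hne
  simp only [Finset.mem_filter, Finset.mem_univ, true_and] at hr
  obtain ⟨hvr, hrq⟩ := hr
  have hqr : q ≤ (r : ℕ) + 1 := (le_nextRow T hq).trans hrq
  have hcoord {i j : Fin n} (hij : i < j) (hj : q ≤ (j : ℕ) + 1) :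
      v j * (2 * v i + v j * T j i) = 0 := by
    obtain ⟨φ, hφ⟩ := hT.exists_coord hij
    rw [← coord_sq hij hφ]
    exact eq_zero_of_mem_flag_mul T hφ hj hxx
  have hv (i : Fin n) (hi : i < r) : 2 * v i = - (v r * T r i) :=
    eq_neg_of_add_eq_zero_left ((mul_eq_zero.1 (hcoord hi hqr)).resolve_left hvr)
  have hql := le_leaderCol_of_nextRow_le hR hrq
  obtain ⟨c, hc⟩ := exists_isLeader (T := T) (r := r) (by omega)
  rw [hc.leaderCol_eq] at hql
  have hcr := hT.lt_of_ne_zero hc.1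
  obtain ⟨i, hic, hΔ⟩ := hR.delta_ne r c hc
  have hvc := hv c hcr
  have hvi := hv i (hic.trans hcr)
  have hvc0 : v c ≠ 0 := by
    intro h0
    rw [h0, mul_zero, eq_comm, neg_eq_zero] at hvc
    exact mul_ne_zero hvr hc.1 hvc
  have hci := (mul_eq_zero.1 (hcoord hic hql)).resolve_left hvc0
  refine mul_ne_zero hvr hΔ ?_
  rw [Delta]
  linear_combination (-2) * hci + 2 * hvi + T c i * hvc

theorem span_eq_flag_nextRow {T : Matrix (Fin n) (Fin n) F} (h2 : (2 : F) ≠ 0) (hT : IsSLTM T)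
    (hR : IsFirstREF T) {q : ℕ} (hq1 : 1 ≤ q) (hq : q ≤ n + 1) :
    Submodule.span F {v | v ∈ component T 2 ∧ v * v ∈ flag T q * flag T q} =
      flag T (nextRow T q) := by
  apply le_antisymm
  · rw [Submodule.span_le]
    rintro v ⟨hv, hvv⟩
    exact mem_flag_nextRow hT hR hq1 hq hv hvv
  · rw [flag, Submodule.span_le]
    rintro _ ⟨r, hr, rfl⟩
    exact gen_mem_span_of_lt_nextRow h2 hT hr

theorem nextRow_iterate_mem (T : Matrix (Fin n) (Fin n) F) (k : ℕ) :
    1 ≤ (nextRow T)^[k] 1 ∧ (nextRow T)^[k] 1 ≤ n + 1 := by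
  induction k with
  | zero => simp
  | succ k ih =>
    rw [Function.iterate_succ_apply']
    exact ⟨ih.1.trans (le_nextRow T ih.2), nextRow_le T _⟩

theorem sqFiltration_eq_flag {T : Matrix (Fin n) (Fin n) F} (h2 : (2 : F) ≠ 0) (hT : IsSLTM T)
    (hR : IsFirstREF T) (k : ℕ) : sqFiltration T k = flag T ((nextRow T)^[k] 1) := by
  induction k with
  | zero =>
    rw [sqFiltration, Function.iterate_zero, id, flag, eq_comm, Submodule.span_eq_bot]
    rintro _ ⟨j, hj, rfl⟩
    exact absurd hj (by simp)
  | succ k ih =>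
    have hk := nextRow_iterate_mem T k
    rw [sqFiltration, ih, Function.iterate_succ_apply', span_eq_flag_nextRow h2 hT hR hk.1 hk.2]

/-- The summand `1` appears because the flag below `q` has dimension `q - 1`. -/
theorem IsFirstREF.finrank_sqFiltration {T : Matrix (Fin n) (Fin n) F} (h2 : (2 : F) ≠ 0)
    (hT : IsSLTM T) (hR : IsFirstREF T) (k : ℕ) :
    Module.finrank F (sqFiltration T k) + 1 = (nextRow T)^[k] 1 := by
  obtain ⟨h1, hn⟩ := nextRow_iterate_mem T k
  obtain ⟨m, hm⟩ := Nat.exists_eq_add_of_le' h1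
  rw [sqFiltration_eq_flag h2 hT hR, hm, hT.finrank_flag (by omega)]

/-! ### Walls as orbits of `nextRow` -/

theorem wallFrom_eq (T : Matrix (Fin n) (Fin n) F) (q : ℕ) :
    wallFrom T q = q :: if nextRow T q ≤ n then wallFrom T (nextRow T q) else [] := by
  rw [wallFrom]
  congr 1
  by_cases h : (laterRows T q).Nonempty
  · have hle := (lt_of_mem_laterRows (Finset.min'_mem _ h)).2
    have hnext : nextRow T q = (laterRows T q).min' h := dif_pos h
    rw [dif_pos h, hnext, if_pos hle]
  · have hnext : nextRow T q = n + 1 := dif_neg h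
    rw [dif_neg h, hnext, if_neg (by omega)]

theorem wallFrom_congr {S T : Matrix (Fin n) (Fin n) F} (q : ℕ)
    (h : ∀ k, (nextRow S)^[k] q = (nextRow T)^[k] q) : wallFrom S q = wallFrom T q := by
  induction hm : n - q using Nat.strong_induction_on generalizing q with
  | _ m ih =>
    have h1 : nextRow S q = nextRow T q := h 1
    rw [wallFrom_eq S, wallFrom_eq T, h1]
    split_ifs with hle
    · rcases le_or_gt q n with hq | hq
      · have hlt := lt_nextRow T hq
        rw [ih (n - nextRow T q) (by omega) (nextRow T q) (fun k => ?_) rfl]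
        have := h (k + 1)
        rwa [Function.iterate_succ_apply, Function.iterate_succ_apply, h1] at this
      -- For `q > n` there are no later rows, so `nextRow` takes the value `n + 1`, contrary to
      -- `hle`.
      · exfalso
        unfold nextRow at hle
        split_ifs at hle with hne
        · have := lt_of_mem_laterRows (Finset.min'_mem _ hne)
          omega
        · omega
    · rfl

/-- The first row of `T` is zero, so the nonzero rows are exactly the later rows of `1`, and the
wall follows the orbit of `1` without its starting point. -/
theorem IsSLTM.wall_eq {T : Matrix (Fin n) (Fin n) F} (hT : IsSLTM T) :
    wall T = if nextRow T 1 ≤ n then wallFrom T (nextRow T 1) else [0] := by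
  have hrows : nonzeroRows T = laterRows T 1 := by
    unfold nonzeroRows laterRows
    congr 1
    refine Finset.filter_congr fun r _ => ?_
    have := hT.leaderCol_le r
    omega
  unfold wall
  simp only [hrows]
  by_cases h : (laterRows T 1).Nonempty
  · have hle := (lt_of_mem_laterRows (Finset.min'_mem _ h)).2
    have hnext : nextRow T 1 = (laterRows T 1).min' h := dif_pos h
    rw [dif_pos h, hnext, if_pos hle]
  · have hnext : nextRow T 1 = n + 1 := dif_neg h
    rw [dif_neg h, hnext, if_neg (by omega)]

theorem Sim.wall_eq {S T : Matrix (Fin n) (Fin n) F} (h2 : (2 : F) ≠ 0) (h : Sim S T)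
    (hS : IsSLTM S) (hT : IsSLTM T) (hSR : IsFirstREF S) (hTR : IsFirstREF T) :
    wall S = wall T := by
  have hk (k : ℕ) : (nextRow S)^[k] 1 = (nextRow T)^[k] 1 := by
    rw [← hSR.finrank_sqFiltration h2 hS, ← hTR.finrank_sqFiltration h2 hT,
      h.finrank_sqFiltration]
  have h1 : nextRow S 1 = nextRow T 1 := hk 1
  rw [hS.wall_eq, hT.wall_eq, h1, wallFrom_congr]
  intro k
  have := hk (k + 1)
  rwa [Function.iterate_succ_apply, Function.iterate_succ_apply, h1] at this

theorem Sim.generalWall_eq {T R : Matrix (Fin n) (Fin n) F} (h2 : (2 : F) ≠ 0) (h : Sim T R)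
    (hR : IsSLTM R) (hRR : IsFirstREF R) : generalWall T = wall R := by
  have hex : ∃ R : Matrix (Fin n) (Fin n) F, IsSLTM R ∧ IsFirstREF R ∧ Sim T R := ⟨R, hR, hRR, h⟩
  obtain ⟨hR', hRR', h'⟩ := hex.choose_spec
  rw [generalWall, dif_pos hex]
  exact (h'.symm.trans h).wall_eq h2 hR' hR hRR' hRR

end SLTM

theorem mainTheorem1 {F : Type*} [Field F] [DecidableEq F] (hF : ringChar F ≠ 2) :
    -- the wall test for matrices in first reduced echelon form
    (∀ (n : ℕ) (S T : Matrix (Fin n) (Fin n) F), SLTM.IsSLTM S → SLTM.IsSLTM T →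
      SLTM.IsFirstREF S → SLTM.IsFirstREF T → SLTM.Sim S T → SLTM.wall S = SLTM.wall T) ∧
    -- the extension of the wall to all strictly lower triangular matrices is well defined
    (∀ (n : ℕ) (T : Matrix (Fin n) (Fin n) F), SLTM.IsSLTM T →
      (∃ R : Matrix (Fin n) (Fin n) F, SLTM.IsSLTM R ∧ SLTM.IsFirstREF R ∧ SLTM.Sim T R) ∧
      ∀ R : Matrix (Fin n) (Fin n) F, SLTM.IsSLTM R → SLTM.IsFirstREF R → SLTM.Sim T R →
        SLTM.generalWall T = SLTM.wall R) ∧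
    -- the extended wall is an invariant of the graded algebra
    (∀ (m n : ℕ) (T : Matrix (Fin m) (Fin m) F) (S : Matrix (Fin n) (Fin n) F),
      SLTM.IsSLTM T → SLTM.IsSLTM S → SLTM.Sim T S →
        SLTM.generalWall T = SLTM.generalWall S) := by
  have h2 : (2 : F) ≠ 0 := Ring.two_ne_zero hF
  refine ⟨fun n S T hS hT hSR hTR h => h.wall_eq h2 hS hT hSR hTR,
    fun n T hT => ⟨hT.exists_isFirstREF h2, fun R hR hRR h => h.generalWall_eq h2 hR hRR⟩,
    fun m n T S hT hS h => ?_⟩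
  -- `generalWall` refers only to forms `R` of the same size; once the sizes agree, a form of `S` is
  -- also one of `T`.
  obtain rfl := h.size_eq hT hS
  obtain ⟨R, hR, hRR, hSR⟩ := hS.exists_isFirstREF h2
  rw [hSR.generalWall_eq h2 hR hRR, (h.trans hSR).generalWall_eq h2 hR hRR]
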